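/- Consider Bayesian single-parameter mechanism design with a graphical-matroid constraint. There is a multigraph $G$ (parallel edges and loops allowed) whose finite edge set $E$ is the set of agents. Agent $i\in E$ has a value $v_i\ge 0$ for being served. The values are independent, and $v_i$ has an arbitrary probability distribution $D_i$ on $[0,\infty)$; no regularity assumption is made. A set of agents may be served if and only if it lies in $\mathcal J$, the family of edge sets that contain no cycle of $G$ (the forests). A mechanism maps each profile $v\in[0,\infty)^E$, measurably, to an allocation $M(v)\in\mathcal J$ and payments $\pi_i(v)\ge 0$. It is truthful if it is individually rational and truthful reporting is a dominant strategy for every agent. Let $\mathcal R^{\mathrm{Mye}}$, the revenue of Myerson's optimal mechanism, be the supremum of the expected revenue $\mathbb E_v\big[\sum_i \pi_i(v)\big]$ over all truthful mechanisms, and assume $\mathcal R^{\mathrm{Mye}}<\infty$. For prices $p\in[0,\infty)^E$ and a set system $\mathcal J'\subseteq\mathcal J$, the order-oblivious posted pricing $p$ with restricted feasibility $\mathcal J'$ has expected revenue $$\mathcal R(p,\mathcal J')=\mathbb E_v\Big[\min_{S\in\mathcal S_v}\sum_{i\in S}p_i\Big],$$ where $\mathcal S_v$ is the class of inclusion-maximal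 sets among the sets $S\in\mathcal J'$ with $v_i\ge p_i$ for all $i\in S$. **Theorem.** There exist prices $p\in[0,\infty)^E$ and a nonempty downward-closed set system $\mathcal J'\subseteq\mathcal J$, both depending only on $G$ and the distributions $D_i$ and not on the realized values, such that $$\mathcal R^{\mathrm{Mye}}\le 3\,\mathcal R(p,\mathcal J').$$ -/

import Mathlib

open scoped NNReal ENNReal
open MeasureTheory

namespace BSMD

/-- `S` contains a cycle of the multigraph `G`: distinct vertices `u 0, …, u k` and distinct edges
`e 0, …, e k` of `S` such that `e j` joins `u j` to its cyclic successor. The index type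
`Fin (k + 1)` wraps around, so `k = 0` is a loop and `k = 1` a pair of parallel edges. -/
def ContainsCycle {V ι : Type*} (G : Graph V ι) (S : Finset ι) : Prop :=
  ∃ (k : ℕ) (u : Fin (k + 1) → V) (e : Fin (k + 1) → ι),
    Function.Injective u ∧ Function.Injective e ∧
      ∀ j, e j ∈ S ∧ G.IsLink (e j) (u j) (u (j + 1))

/-- The independent sets of the graphical matroid of `G`: the sets of edges that form a forest. -/
def graphicalFeasible {V ι : Type*} (G : Graph V ι) : Set (Finset ι) :=
  {S | (∀ i ∈ S, i ∈ G.edgeSet) ∧ ¬ ContainsCycle G S}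

section Mechanisms

variable {ι : Type*} [Fintype ι] [DecidableEq ι]

/-- A (deterministic, direct) mechanism for the feasibility constraint `J`: it maps a profile of
reported values to a feasible allocation and to payments. -/
structure Mechanism (ι : Type*) (J : Set (Finset ι)) where
  alloc : (ι → ℝ≥0) → Finset ι
  pay : (ι → ℝ≥0) → ι → ℝ≥0
  feasible : ∀ v, alloc v ∈ J
  measurableSet_alloc : ∀ i, MeasurableSet {v | i ∈ alloc v}
  measurable_pay : ∀ i, Measurable fun v => pay v i

/-- Utility of agent `i` with true value `x` when the reported profile is `b`. -/
noncomputable def Mechanism.utility {J : Set (Finset ι)} (M : Mechanism ι J)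
    (i : ι) (x : ℝ≥0) (b : ι → ℝ≥0) : ℝ :=
  (if i ∈ M.alloc b then (x : ℝ) else 0) - (M.pay b i : ℝ)

/-- Dominant-strategy truthful and individually rational. As payments are nonnegative, individual
rationality makes an agent that is not served pay nothing. -/
def Mechanism.IsTruthful {J : Set (Finset ι)} (M : Mechanism ι J) : Prop :=
  (∀ (v : ι → ℝ≥0) (i : ι), 0 ≤ M.utility i (v i) v) ∧
  ∀ (v : ι → ℝ≥0) (i : ι) (b : ℝ≥0),
    M.utility i (v i) (Function.update v i b) ≤ M.utility i (v i) v

/-- Expected revenue when the values are independent and agent `i`'s value has law `D i`. -/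
noncomputable def Mechanism.revenue {J : Set (Finset ι)} (M : Mechanism ι J)
    (D : ι → Measure ℝ≥0) : ℝ≥0∞ :=
  ∫⁻ v, ∑ i, (M.pay v i : ℝ≥0∞) ∂(Measure.pi D)

/-- The revenue of the Bayesian optimal (Myerson) mechanism: the optimal expected revenue over
truthful mechanisms. -/
noncomputable def myersonRevenue (D : ι → Measure ℝ≥0) (J : Set (Finset ι)) : ℝ≥0∞ :=
  ⨆ (M : Mechanism ι J) (_ : M.IsTruthful), M.revenue D

/-- The class `𝒮_v` of maximal sets among the feasible sets all of whose members desire service at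
prices `p`, that is, have value at least their price. -/
def maximalServed (J : Set (Finset ι)) (p v : ι → ℝ≥0) : Set (Finset ι) :=
  {S | Maximal (fun T : Finset ι => T ∈ J ∧ ∀ i ∈ T, p i ≤ v i) S}

/-- Expected revenue of the order-oblivious posted pricing with prices `p` run with feasibility
system `J`: the expectation, over the values, of the least revenue of a maximal feasible set of
agents that desire service. -/
noncomputable def obliviousRevenue (D : ι → Measure ℝ≥0) (J : Set (Finset ι))
    (p : ι → ℝ≥0) : ℝ≥0∞ :=
  ∫⁻ v, ⨅ S ∈ maximalServed J p v, ∑ i ∈ S, (p i : ℝ≥0∞) ∂(Measure.pi D)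

end Mechanisms

end BSMD

/-! Fix a nearly optimal truthful mechanism. Its allocations are forests, so its serving
probabilities satisfy the forest polytope inequalities (`Mechanism.sum_spanned_le`). Averaging
degrees, every vertex set has a vertex of weighted degree below 2; removing such vertices in turn
ranks the vertices (`exists_rank`). Group each edge with its lower endpoint: groups have weight at
most some c < 2, and one loopless edge per group always gives a forest (`exists_grouping`).

Each group is now a single-item problem. Take T to be the group's revenue divided by 1 + c', with c
< c' < 2. An agent's revenue is at most T times its serving probability plus its best surplus over T
(`lintegral_pay_le`), so the surpluses total more than T. Hence suitable prices above T collect T in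
expectation, whichever acceptor is served (`le_lintegral_groupBound`). Summing over groups loses a
factor 1 + c' < 3, and the slack pays for near-optimality. -/

namespace BSMD

/-! ### Forests, the degree ranking and the grouping of edges. -/

section Forests

variable {V ι : Type*}

/-- The edge `e` joins `u` to another vertex of `U`. -/
def JoinsInto (G : Graph V ι) (U : Finset V) (u : V) (e : ι) : Prop :=
  ∃ v ∈ U, v ≠ u ∧ G.IsLink e u v

/-- The edge `e` joins two distinct vertices of `U`. -/
def Spanned (G : Graph V ι) (U : Finset V) (e : ι) : Prop :=
  ∃ u ∈ U, JoinsInto G U u e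

/-- A closed non-backtracking walk contains a cycle. -/
theorem containsCycle_of_walk {G : Graph V ι} {S : Finset ι} {U : Finset V}
    (u : ℕ → V) (e : ℕ → ι) (hu : ∀ n, u n ∈ U) (heS : ∀ n, e n ∈ S)
    (hlink : ∀ n, G.IsLink (e n) (u n) (u (n + 1))) (hne : ∀ n, e (n + 1) ≠ e n) :
    ContainsCycle G S := by
  classical
  have hrep : ∃ d, 0 < d ∧ ∃ i, u i = u (i + d) := by
    obtain ⟨a, b, hab, h⟩ := Finite.exists_ne_map_eq_of_infinite (fun n => (⟨u n, hu n⟩ : U))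
    have h : u a = u b := congrArg Subtype.val h
    rcases lt_or_gt_of_ne hab with hlt | hlt
    · exact ⟨b - a, by omega, a, by rw [h]; congr 1; omega⟩
    · exact ⟨a - b, by omega, b, by rw [← h]; congr 1; omega⟩
  -- The gap is the least over all starting points, so the vertices strictly within one gap are
  -- distinct.
  obtain ⟨hd, i, hi⟩ := Nat.find_spec hrep
  have hmin : ∀ a b, a < b → b < a + Nat.find hrep → u a ≠ u b := by
    intro a b hab hb h
    exact Nat.find_min hrep (m := b - a) (by omega)
      ⟨by omega, a, by rw [h]; congr 1; omega⟩
  generalize Nat.find hrep = d at *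
  obtain ⟨k, rfl⟩ : ∃ k, d = k + 1 := ⟨d - 1, by omega⟩
  refine ⟨k, fun j => u (i + j), fun j => e (i + j), ?_, ?_, ?_⟩
  · intro a b h
    have ha := a.isLt
    have hb := b.isLt
    rcases lt_trichotomy (a : ℕ) b with hlt | heq | hlt
    · exact absurd h (hmin _ _ (by omega) (by omega))
    · exact Fin.ext heq
    · exact absurd h.symm (hmin _ _ (by omega) (by omega))
  · have key : ∀ a b : ℕ, a < b → b < k + 1 → e (i + a) ≠ e (i + b) := by
      intro a b hab hb h
      have h1 := hlink (i + a)
      rw [h] at h1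
      rcases h1.eq_and_eq_or_eq_and_eq (hlink (i + b)) with ⟨h2, -⟩ | ⟨-, h2⟩
      · exact hmin _ _ (by omega) (by omega) h2
      · rcases Nat.lt_or_ge (a + 1) b with hlt | hge
        · exact hmin _ _ (by omega) (by omega) h2
        -- An edge retraced at once repeats no vertex within the gap; only `hne` excludes it.
        · obtain rfl : b = a + 1 := by omega
          exact hne _ h.symm
    intro a b h
    have ha := a.isLt
    have hb := b.isLt
    rcases lt_trichotomy (a : ℕ) b with hlt | heq | hlt
    · exact absurd h (key _ _ hlt hb)
    · exact Fin.ext heq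
    · exact absurd h.symm (key _ _ hlt ha)
  · intro j
    refine ⟨heS _, ?_⟩
    have h := hlink (i + j)
    rcases eq_or_ne j (Fin.last k) with rfl | hj
    · simpa [hi, add_assoc] using h
    · beta_reduce
      rwa [Fin.val_add_one_of_lt (Fin.lt_last_iff_ne_last.2 hj)]

open Classical in
/-- A forest has a vertex of degree at most one in every nonempty set of vertices. -/
theorem exists_leaf {G : Graph V ι} {S : Finset ι} (hS : ¬ ContainsCycle G S) {U : Finset V}
    (hU : U.Nonempty) : ∃ u ∈ U, (S.filter (JoinsInto G U u)).card ≤ 1 := by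
  by_contra! hdeg
  -- A state is a vertex with the edge of arrival; degree at least two provides another edge to
  -- leave by.
  have hnext : ∀ s : U × ι, ∃ t : U × ι, t.2 ∈ S ∧ t.2 ≠ s.2 ∧ G.IsLink t.2 s.1 t.1 := by
    rintro ⟨⟨u, hu⟩, e⟩
    obtain ⟨e', he', hne⟩ := Finset.exists_mem_ne (hdeg u hu) e
    obtain ⟨he'S, v, hv, -, hl⟩ := Finset.mem_filter.1 he'
    exact ⟨(⟨v, hv⟩, e'), he'S, hne, hl⟩
  choose f hfS hfne hfl using hnext
  obtain ⟨u₀, hu₀⟩ := hU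
  obtain ⟨e₀, -⟩ := Finset.card_pos.1 (zero_lt_one.trans (hdeg u₀ hu₀))
  let s : ℕ → U × ι := fun n => f^[n] (⟨u₀, hu₀⟩, e₀)
  have hs : ∀ n, s (n + 1) = f (s n) := fun n => Function.iterate_succ_apply' f n _
  refine hS (containsCycle_of_walk (U := U) (fun n => ((s n).1 : V)) (fun n => (s (n + 1)).2)
    (fun n => (s n).1.2) (fun n => ?_) (fun n => ?_) (fun n => ?_))
  · rw [hs]; exact hfS _
  · simp only [hs]; exact hfl _
  · rw [hs (n + 1)]; exact hfne _

open Classical in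
/-- A forest has fewer edges than vertices. -/
theorem card_spanned_lt {G : Graph V ι} {S : Finset ι} (hS : ¬ ContainsCycle G S) (U : Finset V)
    (hU : U.Nonempty) : (S.filter (Spanned G U)).card + 1 ≤ U.card := by
  induction hn : U.card using Nat.strong_induction_on generalizing U with
  | _ n ih =>
    subst hn
    obtain ⟨u, hu, hdeg⟩ := exists_leaf hS hU
    have hsub : S.filter (Spanned G U) ⊆
        S.filter (JoinsInto G U u) ∪ S.filter (Spanned G (U.erase u)) := by
      intro e he
      obtain ⟨heS, a, ha, b, hb, hba, hl⟩ := Finset.mem_filter.1 he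
      simp only [Finset.mem_union, Finset.mem_filter, heS, true_and]
      by_cases hau : a = u
      · subst hau; exact Or.inl ⟨b, hb, hba, hl⟩
      by_cases hbu : b = u
      · subst hbu; exact Or.inl ⟨a, ha, hba.symm, hl.symm⟩
      exact Or.inr ⟨a, Finset.mem_erase.2 ⟨hau, ha⟩, b, Finset.mem_erase.2 ⟨hbu, hb⟩, hba, hl⟩
    have hcard := (Finset.card_le_card hsub).trans (Finset.card_union_le _ _)
    have herase := Finset.card_erase_add_one hu
    rcases (U.erase u).eq_empty_or_nonempty with hempty | hne
    · have h0 : S.filter (Spanned G U) = ∅ := by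
        refine Finset.filter_eq_empty_iff.2 fun e _ => ?_
        rintro ⟨a, ha, b, hb, hba, -⟩
        have h1 : ∀ x ∈ U, x = u := fun x hx => by
          by_contra hxu
          have := Finset.mem_erase.2 ⟨hxu, hx⟩
          simp [hempty] at this
        exact hba ((h1 b hb).trans (h1 a ha).symm)
      rw [h0]
      simpa using hU.card_pos
    · have := ih _ (by omega) _ hne rfl
      omega

open Classical in
/-- If the weights of the edges spanned by any `U` add up to at most `|U| - 1`, then every nonempty
`U` has a vertex of weighted degree at most `2 - 2 / |U|`. -/
theorem exists_small_degree [Fintype ι] {G : Graph V ι} {x : ι → ℝ} (hx : ∀ e, 0 ≤ x e)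
    {U : Finset V} (hU : U.Nonempty)
    (hsum : ∑ e with Spanned G U e, x e ≤ (U.card : ℝ) - 1) :
    ∃ u ∈ U, ∑ e with JoinsInto G U u e, x e ≤ 2 - 2 / (U.card : ℝ) := by
  have hpos : (0 : ℝ) < U.card := by exact_mod_cast hU.card_pos
  -- Each spanned edge is counted at no more than two vertices, so the average degree is at most
  -- 2(|U| - 1)/|U|.
  have hdouble : ∑ u ∈ U, ∑ e with JoinsInto G U u e, x e ≤
      ∑ e with Spanned G U e, 2 * x e := by
    simp_rw [Finset.sum_filter]
    rw [Finset.sum_comm]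
    refine Finset.sum_le_sum fun e _ => ?_
    rw [← Finset.sum_filter, Finset.sum_const, nsmul_eq_mul]
    split_ifs with he
    · obtain ⟨a, ha, b, hb, hba, hl⟩ := he
      refine mul_le_mul_of_nonneg_right ?_ (hx e)
      have : (U.filter fun u => JoinsInto G U u e) ⊆ {a, b} := by
        intro u hu
        obtain ⟨-, v, -, -, hl'⟩ := Finset.mem_filter.1 hu
        rcases hl'.eq_and_eq_or_eq_and_eq hl with ⟨h, -⟩ | ⟨h, -⟩ <;> simp [h]
      exact_mod_cast (Finset.card_le_card this).trans Finset.card_le_two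
    · rw [Finset.filter_false_of_mem fun u hu h => he ⟨u, hu, h⟩]
      simp
  refine Finset.exists_le_of_sum_le hU ?_
  rw [Finset.sum_const, nsmul_eq_mul]
  rw [← Finset.mul_sum] at hdouble
  have : (U.card : ℝ) * (2 - 2 / U.card) = 2 * (U.card - 1) := by field_simp
  linarith

open Classical in
/-- Removing vertices of small weighted degree one by one ranks the vertices so that each of them
has small weighted degree towards those of higher rank. -/
theorem exists_rank [Fintype ι] {G : Graph V ι} {x : ι → ℝ} (hx : ∀ e, 0 ≤ x e)
    (hsum : ∀ U : Finset V, U.Nonempty → ∑ e with Spanned G U e, x e ≤ (U.card : ℝ) - 1)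
    {c : ℝ} (U : Finset V) (hc : 2 - 2 / ((U.card : ℝ) + 1) ≤ c) :
    ∃ ρ : V → ℕ, Set.InjOn ρ U ∧
      ∀ u ∈ U, ∑ e with (∃ v ∈ U, ρ u < ρ v ∧ G.IsLink e u v), x e ≤ c := by
  induction hn : U.card generalizing U with
  | zero =>
    obtain rfl := Finset.card_eq_zero.1 hn
    exact ⟨fun _ => 0, by simp, by simp⟩
  | succ n ih =>
    have hU : U.Nonempty := Finset.card_pos.1 (by omega)
    obtain ⟨u₀, hu₀, hdeg⟩ := exists_small_degree hx hU (hsum U hU)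
    have herase := Finset.card_erase_of_mem hu₀
    obtain ⟨ρ, hinj, hρ⟩ := ih (U.erase u₀) (by
      refine le_trans ?_ hc
      have : ((U.erase u₀).card : ℝ) ≤ U.card := by exact_mod_cast Finset.card_erase_le
      gcongr) (by omega)
    -- The removed vertex goes below all others, so its whole degree in `U` counts; the others do
    -- not see it.
    refine ⟨fun v => if v = u₀ then 0 else ρ v + 1, ?_, ?_⟩
    · intro a ha b hb hab
      by_cases ha0 : a = u₀ <;> by_cases hb0 : b = u₀ <;> simp only [ha0, hb0, if_true, if_false] at hab
      · rw [ha0, hb0]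
      · omega
      · omega
      · exact hinj (by simp_all) (by simp_all) (Nat.succ_injective hab)
    · intro u hu
      by_cases hu0 : u = u₀
      · subst hu0
        refine le_trans (Finset.sum_le_sum_of_subset_of_nonneg ?_ fun e _ _ => hx e)
          (hdeg.trans (le_trans ?_ hc))
        · intro e he
          obtain ⟨v, hv, hlt, hl⟩ := (Finset.mem_filter.1 he).2
          refine Finset.mem_filter.2 ⟨Finset.mem_univ _, v, hv, ?_, hl⟩
          rintro rfl
          exact lt_irrefl _ hlt
        · have : (0 : ℝ) < U.card := by exact_mod_cast hU.card_pos
          gcongr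
          linarith
      · refine le_trans (Finset.sum_le_sum_of_subset_of_nonneg ?_ fun e _ _ => hx e)
          (hρ u (Finset.mem_erase.2 ⟨hu0, hu⟩))
        intro e he
        obtain ⟨v, hv, hlt, hl⟩ := (Finset.mem_filter.1 he).2
        by_cases hv0 : v = u₀
        · simp [hv0] at hlt
        · refine Finset.mem_filter.2 ⟨Finset.mem_univ _, v, Finset.mem_erase.2 ⟨hv0, hv⟩, ?_, hl⟩
          simpa [hu0, hv0] using hlt

/-- Choosing at most one loopless edge per lower endpoint never creates a cycle. -/
theorem not_containsCycle_of_injOn {G : Graph V ι} {S : Finset ι} {U : Finset V} {ρ : V → ℕ}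
    {g : ι → V} (hinj : Set.InjOn ρ U) (hU : ∀ e a b, G.IsLink e a b → a ∈ U)
    (hg : ∀ e a b, G.IsLink e a b → ρ a < ρ b → g e = a)
    (hloop : ∀ e ∈ S, ∀ a, ¬ G.IsLink e a a) (hS : Set.InjOn g S) : ¬ ContainsCycle G S := by
  rintro ⟨k, u, e, hu, he, h⟩
  -- Both cycle edges at the lowest vertex of a cycle are grouped there, against injectivity.
  obtain ⟨j, -, hj⟩ := Finset.exists_min_image Finset.univ (fun j => ρ (u j)) Finset.univ_nonempty
  have hlt : ∀ i, i ≠ j → ρ (u j) < ρ (u i) := fun i hij =>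
    lt_of_le_of_ne (hj i (Finset.mem_univ _)) fun heq =>
      hij (hu (hinj (hU _ _ _ (h j).2) (hU _ _ _ (h i).2) heq)).symm
  have hstep : ∀ i : Fin (k + 1), i + 1 ≠ i := fun i hi => by
    have := (h i).2
    rw [hi] at this
    exact hloop _ (h i).1 _ this
  have h1 : g (e j) = u j := hg _ _ _ (h j).2 (hlt _ (hstep j))
  have hprev := (h (j - 1)).2
  rw [sub_add_cancel] at hprev
  have hjne : j - 1 ≠ j := fun hi => hstep (j - 1) (by rw [sub_add_cancel, hi])
  have h2 : g (e (j - 1)) = u j := hg _ _ _ hprev.symm (hlt _ hjne)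
  exact hjne (he (hS (h _).1 (h _).1 (h2.trans h1.symm)))

open Classical in
/-- For weights in the forest polytope, the edges can be grouped so that a loopless set with at
most one edge of each group is a forest, while each group has weight bounded by a constant below
`2`, which depends on the graph only. -/
theorem exists_grouping [Fintype ι] (G : Graph V ι) (hG : G.edgeSet = Set.univ) :
    ∃ c : ℝ, 0 ≤ c ∧ c < 2 ∧ ∀ x : ι → ℝ, (∀ e, 0 ≤ x e) →
      (∀ U : Finset V, U.Nonempty → ∑ e with Spanned G U e, x e ≤ (U.card : ℝ) - 1) →
      ∃ g : ι → V,
        (∀ S : Finset ι, (∀ e ∈ S, ∀ a, ¬ G.IsLink e a a) → Set.InjOn g S →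
          ¬ ContainsCycle G S) ∧
        ∀ a, ∑ e with ((∀ b, ¬ G.IsLink e b b) ∧ g e = a), x e ≤ c := by
  have hlink : ∀ e, ∃ a b, G.IsLink e a b := fun e => by
    have : e ∈ G.edgeSet := hG ▸ Set.mem_univ e
    exact Graph.exists_isLink_of_mem_edgeSet this
  choose s t hst using hlink
  let U : Finset V := Finset.univ.image s ∪ Finset.univ.image t
  have hU : ∀ e a b, G.IsLink e a b → a ∈ U := by
    intro e a b h
    rcases h.eq_and_eq_or_eq_and_eq (hst e) with ⟨rfl, -⟩ | ⟨rfl, -⟩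
    · simp [U]
    · simp [U]
  have hpos : (0 : ℝ) < (U.card : ℝ) + 1 := by positivity
  -- The `+ 1` keeps the constant below 2 when `U` is empty.
  refine ⟨2 - 2 / ((U.card : ℝ) + 1), ?_, ?_, ?_⟩
  · rw [sub_nonneg, div_le_iff₀ hpos]
    linarith [(Nat.cast_nonneg U.card : (0 : ℝ) ≤ _)]
  · have : 0 < 2 / ((U.card : ℝ) + 1) := by positivity
    linarith
  · intro x hx hsum
    obtain ⟨ρ, hinj, hρ⟩ := exists_rank hx hsum U le_rfl
    let g : ι → V := fun e => if ρ (s e) < ρ (t e) then s e else t e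
    have hg : ∀ e a b, G.IsLink e a b → ρ a < ρ b → g e = a := by
      intro e a b h hlt
      rcases h.eq_and_eq_or_eq_and_eq (hst e) with ⟨rfl, rfl⟩ | ⟨rfl, rfl⟩
      · simp [g, hlt]
      · simp [g, hlt.le]
    refine ⟨g, fun S hloop hS => not_containsCycle_of_injOn hinj hU hg hloop hS, fun a => ?_⟩
    have hlow : ∀ e, (∀ b, ¬ G.IsLink e b b) → g e = a →
        ∃ v ∈ U, ρ a < ρ v ∧ G.IsLink e a v := by
      intro e hloop hga
      have hne : s e ≠ t e := fun h => hloop (s e) (by simpa [← h] using hst e)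
      rcases lt_trichotomy (ρ (s e)) (ρ (t e)) with h | h | h
      · obtain rfl := (hg e _ _ (hst e) h).symm.trans hga
        exact ⟨_, hU _ _ _ (hst e).symm, h, hst e⟩
      · exact absurd (hinj (hU _ _ _ (hst e)) (hU _ _ _ (hst e).symm) h) hne
      · obtain rfl := (hg e _ _ (hst e).symm h).symm.trans hga
        exact ⟨_, hU _ _ _ (hst e), h, (hst e).symm⟩
    by_cases ha : a ∈ U
    · refine le_trans (Finset.sum_le_sum_of_subset_of_nonneg ?_ fun e _ _ => hx e) (hρ a ha)
      intro e he
      obtain ⟨h1, h2⟩ := (Finset.mem_filter.1 he).2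
      exact Finset.mem_filter.2 ⟨Finset.mem_univ _, hlow e h1 h2⟩
    · rw [Finset.filter_false_of_mem]
      · rw [Finset.sum_empty, sub_nonneg, div_le_iff₀ hpos]
        linarith [(Nat.cast_nonneg U.card : (0 : ℝ) ≤ _)]
      · rintro e - ⟨h1, h2⟩
        obtain ⟨v, -, -, hl⟩ := hlow e h1 h2
        exact ha (hU _ _ _ hl)

end Forests

/-! ### Revenue of one agent in a truthful mechanism. -/

section Truthful

variable {ι : Type*} [DecidableEq ι] {J : Set (Finset ι)} {M : Mechanism ι J}

theorem Mechanism.IsTruthful.pay_le (hM : M.IsTruthful) (v : ι → ℝ≥0) (i : ι) :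
    M.pay v i ≤ if i ∈ M.alloc v then v i else 0 := by
  have h := hM.1 v i
  unfold Mechanism.utility at h
  rw [← NNReal.coe_le_coe]
  split_ifs at h ⊢ <;> simp at h ⊢ <;> linarith

/-- All bids with which an agent is served lead to the same payment. -/
theorem Mechanism.IsTruthful.pay_eq (hM : M.IsTruthful) {v : ι → ℝ≥0} {i : ι} {a b : ℝ≥0}
    (ha : i ∈ M.alloc (Function.update v i a)) (hb : i ∈ M.alloc (Function.update v i b)) :
    M.pay (Function.update v i a) i = M.pay (Function.update v i b) i := by
  have h1 := hM.2 (Function.update v i a) i b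
  have h2 := hM.2 (Function.update v i b) i a
  simp only [Mechanism.utility, Function.update_idem, ha, hb, if_true] at h1 h2
  rw [← NNReal.coe_inj]
  linarith

/-- The best expected surplus over `T` of a posted price for a value with law `μ`. -/
noncomputable def surplus (μ : Measure ℝ≥0) (T : ℝ≥0) : ℝ≥0∞ :=
  ⨆ p : ℝ≥0, ((p - T : ℝ≥0) : ℝ≥0∞) * μ (Set.Ici p)

variable [Fintype ι]

/-- Split the payment into at most `T`, paid only when served, and the excess over `T`. With the
other values fixed, the agent pays a fixed price τ whenever served, and then has value at least τ;
so the expected excess is at most the surplus of the posted price τ. -/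
theorem Mechanism.IsTruthful.lintegral_pay_le (hM : M.IsTruthful) (D : ι → Measure ℝ≥0)
    [∀ i, IsProbabilityMeasure (D i)] (i : ι) (T : ℝ≥0) :
    ∫⁻ v, (M.pay v i : ℝ≥0∞) ∂(Measure.pi D) ≤
      T * Measure.pi D {v | i ∈ M.alloc v} + surplus (D i) T := by
  have hsurplus : ∫⁻ v, ((M.pay v i - T : ℝ≥0) : ℝ≥0∞) ∂(Measure.pi D) ≤
      ∫⁻ _, surplus (D i) T ∂(Measure.pi D) := by
    have hmeas : Measurable fun v => ((M.pay v i - T : ℝ≥0) : ℝ≥0∞) :=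
      ((M.measurable_pay i).sub_const T).coe_nnreal_ennreal
    refine lintegral_le_of_lmarginal_le {i} hmeas measurable_const ?_
    intro v
    simp only [lmarginal_singleton, lintegral_const, measure_univ, mul_one]
    by_cases hserved : ∃ b, i ∈ M.alloc (Function.update v i b)
    · obtain ⟨b, hb⟩ := hserved
      set τ := M.pay (Function.update v i b) i with hτ
      calc ∫⁻ x, ((M.pay (Function.update v i x) i - T : ℝ≥0) : ℝ≥0∞) ∂(D i)
          ≤ ∫⁻ x, (Set.Ici τ).indicator (fun _ => ((τ - T : ℝ≥0) : ℝ≥0∞)) x ∂(D i) := by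
            refine lintegral_mono fun x => ?_
            have hle := hM.pay_le (Function.update v i x) i
            by_cases hx : i ∈ M.alloc (Function.update v i x)
            · have heq := hM.pay_eq hx hb
              rw [if_pos hx, Function.update_self, heq, ← hτ] at hle
              rw [Set.indicator_of_mem (Set.mem_Ici.2 hle), heq]
            · rw [if_neg hx] at hle
              simp [nonpos_iff_eq_zero.1 hle]
        _ = ((τ - T : ℝ≥0) : ℝ≥0∞) * D i (Set.Ici τ) :=
            lintegral_indicator_const measurableSet_Ici _
        _ ≤ surplus (D i) T :=
            le_iSup (fun p : ℝ≥0 => ((p - T : ℝ≥0) : ℝ≥0∞) * D i (Set.Ici p)) τ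
    · push Not at hserved
      have h0 : ∀ x, M.pay (Function.update v i x) i = 0 := fun x => by
        simpa [hserved x] using hM.pay_le (Function.update v i x) i
      simp [h0]
  calc ∫⁻ v, (M.pay v i : ℝ≥0∞) ∂(Measure.pi D)
      ≤ ∫⁻ v, ({v | i ∈ M.alloc v}.indicator (fun _ => (T : ℝ≥0∞)) v
          + ((M.pay v i - T : ℝ≥0) : ℝ≥0∞)) ∂(Measure.pi D) := by
        refine lintegral_mono fun v => ?_
        have hle := hM.pay_le v i
        by_cases hv : i ∈ M.alloc v
        · rw [Set.indicator_of_mem (by exact hv)]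
          rw [← ENNReal.coe_add]
          exact ENNReal.coe_le_coe.2 le_add_tsub
        · rw [if_neg hv] at hle
          simp [nonpos_iff_eq_zero.1 hle]
    _ ≤ _ := by
        rw [lintegral_add_left (measurable_const.indicator (M.measurableSet_alloc i)),
          lintegral_indicator_const (M.measurableSet_alloc i)]
        gcongr
        simpa using hsurplus

end Truthful

/-! ### Pricing a group with one item. -/

section GroupPricing

variable {ι : Type*}

open Classical in
/-- A lower bound on what an order-oblivious pricing `p` with a floor `T` collects from a group `A`
of which one agent can be served: the floor if some agent accepts, and the whole price if exactly
one agent accepts. -/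
noncomputable def groupBound (A : Finset ι) (p : ι → ℝ≥0) (T : ℝ≥0) (v : ι → ℝ≥0) : ℝ≥0∞ :=
  {v : ι → ℝ≥0 | ∀ j ∈ A, v j < p j}ᶜ.indicator (fun _ => (T : ℝ≥0∞)) v +
    ∑ i ∈ A, {v : ι → ℝ≥0 | p i ≤ v i ∧ ∀ j ∈ A, j ≠ i → v j < p j}.indicator
      (fun _ => ((p i - T : ℝ≥0) : ℝ≥0∞)) v

theorem groupBound_eq_zero {A : Finset ι} {p v : ι → ℝ≥0} {T : ℝ≥0} (h : ∀ j ∈ A, v j < p j) :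
    groupBound A p T v = 0 := by
  unfold groupBound
  rw [Set.indicator_of_notMem (by simpa using h), zero_add]
  exact Finset.sum_eq_zero fun i hi => Set.indicator_of_notMem (fun h' => (h i hi).not_ge h'.1) _

theorem groupBound_le {A : Finset ι} {p v : ι → ℝ≥0} {T : ℝ≥0} {j : ι} (hj : j ∈ A)
    (hv : p j ≤ v j) (hT : T ≤ p j) : groupBound A p T v ≤ p j := by
  unfold groupBound
  rw [Finset.sum_eq_single_of_mem j hj fun i _ hij =>
    Set.indicator_of_notMem (fun h' => (h'.2 j hj hij.symm).not_ge hv) _]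
  calc _ ≤ (T : ℝ≥0∞) + ((p j - T : ℝ≥0) : ℝ≥0∞) :=
        add_le_add (Set.indicator_le_self' (fun _ _ => zero_le) v)
          (Set.indicator_le_self' (fun _ _ => zero_le) v)
    _ = p j := by rw [← ENNReal.coe_add, add_tsub_cancel_of_le hT]

theorem measurableSet_all_decline (A : Finset ι) (p : ι → ℝ≥0) :
    MeasurableSet {v : ι → ℝ≥0 | ∀ j ∈ A, v j < p j} := by
  have : {v : ι → ℝ≥0 | ∀ j ∈ A, v j < p j} = ⋂ j ∈ A, {v | v j < p j} := by ext; simp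
  rw [this]
  exact A.measurableSet_biInter fun j _ => measurableSet_lt (measurable_pi_apply j)
    measurable_const

theorem measurableSet_only_accept (A : Finset ι) (p : ι → ℝ≥0) (i : ι) :
    MeasurableSet {v : ι → ℝ≥0 | p i ≤ v i ∧ ∀ j ∈ A, j ≠ i → v j < p j} := by
  have : {v : ι → ℝ≥0 | p i ≤ v i ∧ ∀ j ∈ A, j ≠ i → v j < p j} =
      {v | p i ≤ v i} ∩ ⋂ j ∈ A, ⋂ (_ : j ≠ i), {v | v j < p j} := by ext; simp
  rw [this]
  exact (measurableSet_le measurable_const (measurable_pi_apply i)).inter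
    (A.measurableSet_biInter fun j _ => MeasurableSet.iInter fun _ =>
      measurableSet_lt (measurable_pi_apply j) measurable_const)

theorem measurable_groupBound (A : Finset ι) (p : ι → ℝ≥0) (T : ℝ≥0) :
    Measurable (groupBound A p T) :=
  (measurable_const.indicator (measurableSet_all_decline A p).compl).add
    (Finset.measurable_fun_sum _ fun i _ =>
      measurable_const.indicator (measurableSet_only_accept A p i))

/-- If the best surpluses of a group exceed the floor, then so do those of some prices. -/
theorem exists_prices (D : ι → Measure ℝ≥0) {A : Finset ι} {T : ℝ≥0} (h : (T : ℝ≥0∞) < ∑ i ∈ A, surplus (D i) T) :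
    ∃ p : ι → ℝ≥0, (∀ i, T ≤ p i) ∧
      (T : ℝ≥0∞) ≤ ∑ i ∈ A, ((p i - T : ℝ≥0) : ℝ≥0∞) * D i (Set.Ici (p i)) := by
  let F : ι → ℝ≥0 → ℝ≥0∞ := fun i x => ((x - T : ℝ≥0) : ℝ≥0∞) * D i (Set.Ici x)
  have hsup : ∀ i, surplus (D i) T = ⨆ p : ι → ℝ≥0, F i (p i) := fun i =>
    le_antisymm (iSup_le fun x => le_iSup (fun p : ι → ℝ≥0 => F i (p i)) fun _ => x)
      (iSup_le fun p => le_iSup (F i) (p i))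
  simp_rw [hsup] at h
  rw [ENNReal.finsetSum_iSup, lt_iSup_iff] at h
  · obtain ⟨p, hp⟩ := h
    -- Prices below `T` contribute nothing, so raising them to `T` is free.
    refine ⟨fun i => max (p i) T, fun i => le_max_right _ _, hp.le.trans ?_⟩
    refine Finset.sum_le_sum fun i _ => ?_
    rcases le_total (p i) T with hle | hle
    · simp only [F, tsub_eq_zero_of_le hle, ENNReal.coe_zero, zero_mul, zero_le]
    · simp [F, max_eq_left hle]
  · intro p q
    -- Directedness, needed to exchange sum and supremum: take the better price agent by agent.
    refine ⟨fun i => if F i (p i) ≤ F i (q i) then q i else p i, fun i => ?_⟩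
    dsimp only
    split_ifs with hle
    · exact ⟨hle, le_rfl⟩
    · exact ⟨le_rfl, (not_le.1 hle).le⟩

variable [Fintype ι] (D : ι → Measure ℝ≥0) [∀ i, IsProbabilityMeasure (D i)]

open Classical in
theorem measure_all_decline (A : Finset ι) (p : ι → ℝ≥0) :
    Measure.pi D {v | ∀ j ∈ A, v j < p j} =
      ∏ j, D j (if j ∈ A then Set.Iio (p j) else Set.univ) := by
  rw [← Measure.pi_pi]
  congr 1
  ext v
  simp only [Set.mem_ofPred_eq, Set.mem_univ_pi]
  refine forall_congr' fun j => ?_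
  split_ifs with h <;> simp [h]

open Classical in
-- By independence both events factor; the left side has at most one extra factor, a probability.
theorem measure_only_accept {A : Finset ι} (p : ι → ℝ≥0) {i : ι} :
    D i (Set.Ici (p i)) * Measure.pi D {v | ∀ j ∈ A, v j < p j} ≤
      Measure.pi D {v | p i ≤ v i ∧ ∀ j ∈ A, j ≠ i → v j < p j} := by
  have hbox : {v : ι → ℝ≥0 | p i ≤ v i ∧ ∀ j ∈ A, j ≠ i → v j < p j} =
      Set.univ.pi fun j => if j = i then Set.Ici (p j) else
        if j ∈ A then Set.Iio (p j) else Set.univ := by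
    ext v
    simp only [Set.mem_ofPred_eq, Set.mem_univ_pi]
    constructor
    · rintro ⟨h1, h2⟩ j
      split_ifs with hji hjA
      · subst hji; exact h1
      · exact h2 j hjA hji
      · trivial
    · intro h
      refine ⟨by simpa using h i, fun j hj hji => by simpa [hj, hji] using h j⟩
  rw [hbox, Measure.pi_pi, measure_all_decline,
    ← Finset.mul_prod_erase Finset.univ _ (Finset.mem_univ i),
    ← Finset.mul_prod_erase Finset.univ _ (Finset.mem_univ i), if_pos rfl]
  gcongr
  refine (mul_le_of_le_one_left' prob_le_one).trans (Finset.prod_le_prod' fun j hj => ?_)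
  rw [if_neg (Finset.ne_of_mem_erase hj)]

/-- Split `T` by whether someone accepts. If nobody does, replace `T` by the sum in `h`; by
`measure_only_accept` each term is then covered by the event that only `i` accepts. -/
theorem le_lintegral_groupBound {A : Finset ι} {p : ι → ℝ≥0} {T : ℝ≥0}
    (h : (T : ℝ≥0∞) ≤ ∑ i ∈ A, ((p i - T : ℝ≥0) : ℝ≥0∞) * D i (Set.Ici (p i))) :
    (T : ℝ≥0∞) ≤ ∫⁻ v, groupBound A p T v ∂(Measure.pi D) := by
  unfold groupBound
  set N := {v : ι → ℝ≥0 | ∀ j ∈ A, v j < p j} with hNdef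
  have hN : MeasurableSet N := measurableSet_all_decline A p
  have hB := measurableSet_only_accept A p
  rw [lintegral_add_left (measurable_const.indicator hN.compl),
    lintegral_finsetSum _ fun i _ => measurable_const.indicator (hB i),
    lintegral_indicator_const hN.compl]
  simp_rw [lintegral_indicator_const (hB _)]
  calc (T : ℝ≥0∞) = T * Measure.pi D Nᶜ + T * Measure.pi D N := by
        rw [← mul_add, add_comm, measure_add_measure_compl hN, measure_univ, mul_one]
    _ ≤ T * Measure.pi D Nᶜ +
        (∑ i ∈ A, ((p i - T : ℝ≥0) : ℝ≥0∞) * D i (Set.Ici (p i))) * Measure.pi D N := by gcongr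
    _ ≤ _ := by
        rw [Finset.sum_mul]
        refine add_le_add le_rfl (Finset.sum_le_sum fun i _ => ?_)
        rw [mul_assoc]
        exact mul_le_mul_right (measure_only_accept D p) _

end GroupPricing

/-! ### From a forest mechanism to a posted pricing. -/

section ForestMechanisms

variable {V ι : Type*}

/-- Loopless edge sets with at most one edge in each group. -/
def groupFeasible (G : Graph V ι) (g : ι → V) : Set (Finset ι) :=
  {S | (∀ e ∈ S, ∀ a, ¬ G.IsLink e a a) ∧ Set.InjOn g S}

theorem isLowerSet_groupFeasible (G : Graph V ι) (g : ι → V) :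
    IsLowerSet (groupFeasible G g) := fun _ _ hle hS =>
  ⟨fun e he => hS.1 e (hle he), hS.2.mono (Finset.coe_subset.2 hle)⟩

/-- A loop is never served by a mechanism for forests. -/
theorem Mechanism.notMem_alloc_of_loop {G : Graph V ι} (M : Mechanism ι (graphicalFeasible G))
    {e : ι} {a : V} (he : G.IsLink e a a) (v : ι → ℝ≥0) : e ∉ M.alloc v := fun hmem =>
  (M.feasible v).2 ⟨0, fun _ => a, fun _ => e, fun _ _ _ => Subsingleton.elim (α := Fin 1) _ _,
    fun _ _ _ => Subsingleton.elim (α := Fin 1) _ _, fun _ => ⟨hmem, he⟩⟩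

variable [Fintype ι]

open Classical in
/-- The loopless edges of a group. -/
noncomputable def group (G : Graph V ι) (g : ι → V) (a : V) : Finset ι :=
  Finset.univ.filter fun e => (∀ b, ¬ G.IsLink e b b) ∧ g e = a

theorem mem_group {G : Graph V ι} {g : ι → V} {a : V} {e : ι} :
    e ∈ group G g a ↔ (∀ b, ¬ G.IsLink e b b) ∧ g e = a := by
  simp [group]

variable [DecidableEq ι]

open Classical in
/-- The serving probabilities of a mechanism for forests lie in the forest polytope. -/
theorem Mechanism.sum_spanned_le {G : Graph V ι} (M : Mechanism ι (graphicalFeasible G))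
    (μ : Measure (ι → ℝ≥0)) [IsProbabilityMeasure μ] (U : Finset V) (hU : U.Nonempty) :
    ∑ e with Spanned G U e, μ.real {v | e ∈ M.alloc v} ≤ (U.card : ℝ) - 1 := by
  -- The polytope inequality holds profile by profile, as each allocation is a forest, and is then
  -- integrated.
  have hint : ∀ e, Integrable ({v | e ∈ M.alloc v}.indicator fun _ => (1 : ℝ)) μ := fun e =>
    (integrable_const 1).indicator (M.measurableSet_alloc e)
  have hreal : ∀ e, μ.real {v | e ∈ M.alloc v} =
      ∫ v, {v | e ∈ M.alloc v}.indicator (fun _ => (1 : ℝ)) v ∂μ := fun e => by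
    rw [integral_indicator_const _ (M.measurableSet_alloc e), smul_eq_mul, mul_one]
  simp_rw [hreal]
  rw [← integral_finsetSum _ fun e _ => hint e]
  calc _ ≤ ∫ _, ((U.card : ℝ) - 1) ∂μ := by
        refine integral_mono (integrable_finsetSum _ fun e _ => hint e) (integrable_const _) ?_
        intro v
        have hcard := card_spanned_lt (M.feasible v).2 U hU
        have hsum : ∑ e with Spanned G U e, {v | e ∈ M.alloc v}.indicator (fun _ => (1 : ℝ)) v =
            ((M.alloc v).filter (Spanned G U)).card := by
          simp only [Set.indicator_apply, Set.mem_ofPred_eq]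
          rw [← Finset.sum_filter, Finset.sum_const, nsmul_eq_mul, mul_one, Finset.filter_filter]
          congr 2
          ext e
          simp [and_comm]
        have hcard' : (((M.alloc v).filter (Spanned G U)).card : ℝ) + 1 ≤ U.card := by
          exact_mod_cast hcard
        simp only [hsum]
        linarith
    _ = _ := by simp

open Classical in
/-- Any maximal served set collects the lower bounds of all groups. -/
theorem sum_groupBound_le {G : Graph V ι} {g : ι → V} {p v : ι → ℝ≥0} {T : V → ℝ≥0}
    (hT : ∀ i, T (g i) ≤ p i) {S : Finset ι} (hS : S ∈ maximalServed (groupFeasible G g) p v) :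
    ∑ a ∈ Finset.univ.image g, groupBound (group G g a) p (T a) v ≤ ∑ i ∈ S, (p i : ℝ≥0∞) := by
  rw [← Finset.sum_fiberwise_of_maps_to (s := S) (t := Finset.univ.image g) (g := g) (by simp)]
  refine Finset.sum_le_sum fun a _ => ?_
  by_cases hdecline : ∀ j ∈ group G g a, v j < p j
  · rw [groupBound_eq_zero hdecline]
    exact zero_le
  push Not at hdecline
  obtain ⟨i, hi, hpi⟩ := hdecline
  obtain ⟨hloop, hgi⟩ := mem_group.1 hi
  obtain ⟨⟨⟨hSloop, hSinj⟩, hSv⟩, hmax⟩ := hS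
  -- Otherwise the acceptor `i` could be added to `S`, against maximality.
  obtain ⟨j, hjS, hgj⟩ : ∃ j ∈ S, g j = a := by
    by_contra! hno
    have hins : insert i S ≤ S := by
      refine hmax ⟨⟨?_, ?_⟩, ?_⟩ (Finset.subset_insert _ _)
      · intro e he
        rcases Finset.mem_insert.1 he with rfl | he
        · exact hloop
        · exact hSloop e he
      · rw [Finset.coe_insert]
        rintro x (rfl | hx) y (rfl | hy) hxy
        · rfl
        · exact absurd (hxy.symm.trans hgi) (hno y hy)
        · exact absurd (hxy.trans hgi) (hno x hx)
        · exact hSinj hx hy hxy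
      · intro e he
        rcases Finset.mem_insert.1 he with rfl | he
        · exact hpi
        · exact hSv e he
    exact hno i (hins (Finset.mem_insert_self _ _)) hgi
  refine (groupBound_le (mem_group.2 ⟨hSloop j hjS, hgj⟩) (hSv j hjS) (hgj ▸ hT j)).trans ?_
  exact Finset.single_le_sum (f := fun i => (p i : ℝ≥0∞)) (fun _ _ => zero_le)
    (Finset.mem_filter.2 ⟨hjS, hgj⟩)

open Classical in
-- The group bounds hold simultaneously for every maximal set, so linearity of expectation suffices,
-- without independence between groups.
theorem sum_le_obliviousRevenue (D : ι → Measure ℝ≥0) [∀ i, IsProbabilityMeasure (D i)]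
    {G : Graph V ι} {g : ι → V} {p : ι → ℝ≥0} {T : V → ℝ≥0} (hT : ∀ i, T (g i) ≤ p i)
    (h : ∀ a, (T a : ℝ≥0∞) ≤
      ∑ i ∈ group G g a, ((p i - T a : ℝ≥0) : ℝ≥0∞) * D i (Set.Ici (p i))) :
    ∑ a ∈ Finset.univ.image g, (T a : ℝ≥0∞) ≤ obliviousRevenue D (groupFeasible G g) p := by
  refine (Finset.sum_le_sum fun a _ => le_lintegral_groupBound D (h a)).trans ?_
  rw [← lintegral_finsetSum _ fun a _ => measurable_groupBound _ _ _]
  unfold obliviousRevenue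
  exact lintegral_mono fun v => le_iInf₂ fun S hS => sum_groupBound_le hT hS

open Classical in
/-- If the serving probabilities of each group add up to at most `c < c'`, then some posted pricing
collects a `1 / (1 + c')` fraction of the revenue of the mechanism. -/
theorem Mechanism.IsTruthful.revenue_le (D : ι → Measure ℝ≥0) [∀ i, IsProbabilityMeasure (D i)]
    {G : Graph V ι} {M : Mechanism ι (graphicalFeasible G)} (hM : M.IsTruthful)
    (hfin : M.revenue D ≠ ⊤) {g : ι → V} {c c' : ℝ≥0} (hc : c < c')
    (hg : ∀ a, ∑ e ∈ group G g a, (Measure.pi D).real {v | e ∈ M.alloc v} ≤ c) :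
    ∃ p : ι → ℝ≥0,
      M.revenue D ≤ ((1 + c' : ℝ≥0) : ℝ≥0∞) * obliviousRevenue D (groupFeasible G g) p := by
  let r : ι → ℝ≥0∞ := fun i => ∫⁻ v, (M.pay v i : ℝ≥0∞) ∂(Measure.pi D)
  have hrev : M.revenue D = ∑ i, r i :=
    lintegral_finsetSum _ fun i _ => (M.measurable_pay i).coe_nnreal_ennreal
  have hr : ∀ i, r i ≠ ⊤ := fun i =>
    ne_top_of_le_ne_top hfin (hrev ▸ Finset.single_le_sum (fun _ _ => zero_le) (Finset.mem_univ i))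
  -- Loops belong to no `group`, so they must carry no revenue.
  have hloop : ∀ i b, G.IsLink i b b → r i = 0 := by
    intro i b hi
    have h0 : ∀ v, M.pay v i = 0 := fun v => by
      simpa [M.notMem_alloc_of_loop hi v] using hM.pay_le v i
    simp [r, h0]
  have hgroup : M.revenue D = ∑ a ∈ Finset.univ.image g, ∑ i ∈ group G g a, r i := by
    rw [hrev, ← Finset.sum_fiberwise_of_maps_to (s := Finset.univ) (t := Finset.univ.image g)
      (g := g) (by simp)]
    refine Finset.sum_congr rfl fun a _ => (Finset.sum_subset ?_ ?_).symm
    · intro i hi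
      simpa using (mem_group.1 hi).2
    · intro i hi hi'
      have : ∃ b, G.IsLink i b b := by
        by_contra! hno
        exact hi' (mem_group.2 ⟨hno, (Finset.mem_filter.1 hi).2⟩)
      obtain ⟨b, hb⟩ := this
      exact hloop i b hb
  -- With group revenue (1 + c')T and weight at most c, the surpluses total at least (1 + c' - c)T.
  -- This exceeds T strictly, as is needed because the suprema need not be attained.
  let T : V → ℝ≥0 := fun a => (∑ i ∈ group G g a, r i).toNNReal / (1 + c')
  have hT : ∀ a, ∑ i ∈ group G g a, r i = (((1 + c') * T a : ℝ≥0) : ℝ≥0∞) := fun a => by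
    rw [mul_div_cancel₀ _ (by positivity),
      ENNReal.coe_toNNReal (ENNReal.sum_ne_top.2 fun i _ => hr i)]
  have hsurplus : ∀ a, 0 < T a → (T a : ℝ≥0∞) < ∑ i ∈ group G g a, surplus (D i) (T a) := by
    intro a ha
    by_contra! hle
    have hprob : ∑ e ∈ group G g a, Measure.pi D {v | e ∈ M.alloc v} ≤ c := by
      rw [← ENNReal.toReal_le_toReal (ENNReal.sum_ne_top.2 fun i _ => measure_ne_top _ _)
        ENNReal.coe_ne_top, ENNReal.toReal_sum fun i _ => measure_ne_top _ _]
      exact hg a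
    have : (((1 + c') * T a : ℝ≥0) : ℝ≥0∞) ≤ ((T a * c + T a : ℝ≥0) : ℝ≥0∞) := by
      rw [← hT]
      calc _ ≤ ∑ i ∈ group G g a, (T a * Measure.pi D {v | i ∈ M.alloc v}
              + surplus (D i) (T a)) :=
            Finset.sum_le_sum fun i _ => hM.lintegral_pay_le D i (T a)
        _ ≤ _ := by
            rw [Finset.sum_add_distrib, ← Finset.mul_sum, ENNReal.coe_add, ENNReal.coe_mul]
            gcongr
    have h1 := ENNReal.coe_le_coe.1 this
    have h2 : T a * c < T a * c' := by gcongr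
    rw [add_mul, one_mul, add_comm, mul_comm c'] at h1
    exact (le_of_add_le_add_right h1).not_gt h2
  have hprices : ∀ a, ∃ p : ι → ℝ≥0, (∀ i, T a ≤ p i) ∧ (T a : ℝ≥0∞) ≤
      ∑ i ∈ group G g a, ((p i - T a : ℝ≥0) : ℝ≥0∞) * D i (Set.Ici (p i)) := by
    intro a
    rcases (zero_le (a := T a)).eq_or_lt with h0 | hpos
    · exact ⟨0, fun i => by simp [← h0], by simp [← h0]⟩
    · exact exists_prices D (hsurplus a hpos)
  choose p hp hpT using hprices
  refine ⟨fun i => p (g i) i, ?_⟩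
  have := sum_le_obliviousRevenue D (G := G) (g := g) (p := fun i => p (g i) i) (T := T)
    (fun i => hp _ i) fun a => (hpT a).trans_eq
      (Finset.sum_congr rfl fun i hi => by rw [(mem_group.1 hi).2])
  rw [hgroup]
  simp_rw [hT, ENNReal.coe_mul]
  rw [← Finset.mul_sum]
  gcongr

end ForestMechanisms

end BSMD

/-! ### The factor 3. -/

theorem mainTheorem10 {V ι : Type*} [Fintype ι] [DecidableEq ι]
    (G : Graph V ι) (hG : G.edgeSet = Set.univ)
    (D : ι → MeasureTheory.Measure ℝ≥0) (hD : ∀ i, MeasureTheory.IsProbabilityMeasure (D i))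
    (hfin : BSMD.myersonRevenue D (BSMD.graphicalFeasible G) ≠ ⊤) :
    ∃ (p : ι → ℝ≥0) (J' : Set (Finset ι)),
      J' ⊆ BSMD.graphicalFeasible G ∧ IsLowerSet J' ∧ ∅ ∈ J' ∧
      BSMD.myersonRevenue D (BSMD.graphicalFeasible G) ≤ 3 * BSMD.obliviousRevenue D J' p := by
  classical
  obtain ⟨c, hc0, hc2, hgrouping⟩ := BSMD.exists_grouping G hG
  lift c to ℝ≥0 using hc0
  -- The gap to c makes the surplus bound strict; the gap to 2 leaves room for a mechanism that is
  -- only nearly optimal.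
  obtain ⟨c', hcc', hc'2⟩ := exists_between (show c < 2 by exact_mod_cast hc2)
  set R := BSMD.myersonRevenue D (BSMD.graphicalFeasible G) with hR
  have hempty : ∅ ∈ BSMD.graphicalFeasible G :=
    ⟨by simp, fun ⟨_, _, _, _, _, h⟩ => by simpa using (h 0).1⟩
  rcases eq_or_ne R 0 with h0 | h0
  -- Zero optimal revenue is set apart, since no mechanism can exceed a fraction of it strictly.
  · refine ⟨0, {∅}, by simpa using hempty, ?_, rfl, by simp [h0]⟩
    rintro S T hTS rfl
    exact Finset.subset_empty.1 hTS
  have hlt : ((1 + c' : ℝ≥0) : ℝ≥0∞) / 3 * R < R := by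
    conv_rhs => rw [← one_mul R]
    refine (ENNReal.mul_lt_mul_iff_left h0 hfin).2 ?_
    rw [ENNReal.div_lt_iff (by simp) (by simp), one_mul]
    have : 1 + c' < 3 := by
      calc 1 + c' < 1 + 2 := by gcongr
        _ = 3 := by norm_num
    exact_mod_cast this
  obtain ⟨M, hM⟩ := lt_iSup_iff.1 (hR ▸ hlt)
  obtain ⟨hMT, hMR⟩ := lt_iSup_iff.1 hM
  have hle : M.revenue D ≤ R := le_iSup₂_of_le M hMT le_rfl
  obtain ⟨g, hforest, hg⟩ := hgrouping (fun e => (Measure.pi D).real {v | e ∈ M.alloc v})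
    (fun _ => measureReal_nonneg) (M.sum_spanned_le (Measure.pi D))
  obtain ⟨p, hp⟩ := hMT.revenue_le D (ne_top_of_le_ne_top hfin hle) hcc' hg
  refine ⟨p, BSMD.groupFeasible G g, fun S hS => ⟨fun i _ => hG ▸ Set.mem_univ i,
    hforest S hS.1 hS.2⟩, BSMD.isLowerSet_groupFeasible G g, ⟨by simp, by simp⟩, ?_⟩
  have hk0 : ((1 + c' : ℝ≥0) : ℝ≥0∞) ≠ 0 := by simp
  have hmul : ((1 + c' : ℝ≥0) : ℝ≥0∞) * (R / 3) ≤
      ((1 + c' : ℝ≥0) : ℝ≥0∞) * BSMD.obliviousRevenue D (BSMD.groupFeasible G g) p := by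
    refine le_trans (le_of_eq ?_) (hMR.le.trans hp)
    rw [ENNReal.div_eq_inv_mul, ENNReal.div_eq_inv_mul]
    ring
  rw [ENNReal.mul_le_mul_iff_right hk0 ENNReal.coe_ne_top,
    ENNReal.div_le_iff (by simp) (by simp), mul_comm] at hmul
  exact hmul
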